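/- Let $H$ be a complex Hilbert space and let $P_Q,P_R$ be orthogonal projections on $H$ such that the spectrum of $(P_Q-P_R)^2$ is $[0,1]$. Let $\mathcal O=\mathcal O(P_Q,P_R)$ be the unital $C^*$-algebra of operators on $H$ generated by $P_Q$ and $P_R$, let $N=(\operatorname{Im}P_Q)^\perp\cap(\operatorname{Im}P_R)^\perp$, and let $\mathcal O'=\{A\in\mathcal O : Af=0 \text{ for all } f\in N\}$, a $*$-closed two-sided ideal of $\mathcal O$ containing $P_Q$ and $P_R$. For every $p\in[0,1]$ there is exactly one unital $*$-representation $\pi_p$ of $\mathcal O$ on $\mathbb C^2$ with $$\pi_p(P_Q)=\begin{pmatrix}1-p&\sqrt{p(1-p)}\\ \sqrt{p(1-p)}&p\end{pmatrix},\qquad \pi_p(P_R)=\begin{pmatrix}1&0\\0&0\end{pmatrix}.$$ The representation of $\mathcal O'$ at the parameter $p$ is the restriction $\pi_p|_{\mathcal O'}$, and it has the following form. 1. For $p=0$ it is unitarily equivalent to $\chi\oplus\chi_0$, where $\chi$ is a one-dimensional representation with $\chi(P_Q)=\chi(P_R)=1$, and $\chi_0:\mathcal O'\to\mathbb C$ is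 a $*$-homomorphism with $\chi_0(P_Q)=\chi_0(P_R)=0$. If $N\neq\{0\}$, then $\chi_0=0$, so that, apart from the zero summand, $\mathcal O'$ has at $p=0$ just the one-dimensional representation $\chi$. 2. For $p\in(0,1)$ it is an irreducible two-dimensional ("spinor") representation, and its image consists of all complex $2\times2$ matrices. 3. For $p=1$ it is reducible, and unitarily equivalent to a direct sum $\chi_1\oplus\chi_2$ of two nonzero one-dimensional representations, with $\chi_1(P_Q)=0$, $\chi_1(P_R)=1$, $\chi_2(P_Q)=1$, $\chi_2(P_R)=0$. -/

import Mathlib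

open scoped InnerProductSpace

noncomputable section

namespace TwoProjections

variable {H : Type*} [NormedAddCommGroup H] [InnerProductSpace ℂ H] [CompleteSpace H]

/-- The unital `C*`-algebra `O(P_Q, P_R)` of operators generated by `P_Q` and `P_R`. -/
def algO (PQ PR : H →L[ℂ] H) : StarSubalgebra ℂ (H →L[ℂ] H) :=
  (StarAlgebra.adjoin ℂ {PQ, PR}).topologicalClosure

/-- The subspace `(Im P_Q)^⊥ ∩ (Im P_R)^⊥`. -/
def coIm (PQ PR : H →L[ℂ] H) : Submodule ℂ H :=
  (PQ.range)ᗮ ⊓ (PR.range)ᗮ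

theorem PQ_mem_algO (PQ PR : H →L[ℂ] H) : PQ ∈ algO PQ PR :=
  StarSubalgebra.le_topologicalClosure _ (StarAlgebra.subset_adjoin ℂ _ (by simp))

theorem PR_mem_algO (PQ PR : H →L[ℂ] H) : PR ∈ algO PQ PR :=
  StarSubalgebra.le_topologicalClosure _ (StarAlgebra.subset_adjoin ℂ _ (by simp))

theorem apply_eq_zero_of_mem_orthogonal {P : H →L[ℂ] H} (hP : IsStarProjection P) {f : H}
    (hf : f ∈ (P.range)ᗮ) : P f = 0 := by
  have h1 : ⟪P (P f), f⟫_ℂ = 0 := (Submodule.mem_orthogonal _ _).1 hf _ ⟨P f, rfl⟩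
  have h2 : ContinuousLinearMap.adjoint P = P := hP.isSelfAdjoint
  rw [← h2, ContinuousLinearMap.adjoint_inner_left, h2] at h1
  exact inner_self_eq_zero.1 h1

theorem coIm_apply_left {PQ PR : H →L[ℂ] H} (hQ : IsStarProjection PQ) {f : H}
    (hf : f ∈ coIm PQ PR) : PQ f = 0 :=
  apply_eq_zero_of_mem_orthogonal hQ hf.1

theorem coIm_apply_right {PQ PR : H →L[ℂ] H} (hR : IsStarProjection PR) {f : H}
    (hf : f ∈ coIm PQ PR) : PR f = 0 :=
  apply_eq_zero_of_mem_orthogonal hR hf.2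

theorem isClosed_coIm (PQ PR : H →L[ℂ] H) : IsClosed (coIm PQ PR : Set H) :=
  (Submodule.isClosed_orthogonal _).inter (Submodule.isClosed_orthogonal _)

/-- Elements of the generated algebra leave `(Im P_Q)^⊥ ∩ (Im P_R)^⊥` invariant. -/
theorem coIm_invariant {PQ PR : H →L[ℂ] H} (hQ : IsStarProjection PQ) (hR : IsStarProjection PR)
    {A : H →L[ℂ] H} (hA : A ∈ algO PQ PR) {f : H} (hf : f ∈ coIm PQ PR) :
    A f ∈ coIm PQ PR := by
  have key : ∀ B ∈ StarAlgebra.adjoin ℂ ({PQ, PR} : Set (H →L[ℂ] H)),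
      (∀ g ∈ coIm PQ PR, B g ∈ coIm PQ PR) ∧ (∀ g ∈ coIm PQ PR, (star B) g ∈ coIm PQ PR) := by
    intro B hB
    induction hB using StarAlgebra.adjoin_induction with
    | mem x hx =>
      rcases hx with rfl | rfl
      · refine ⟨fun g hg => ?_, fun g hg => ?_⟩
        · rw [coIm_apply_left hQ hg]; exact Submodule.zero_mem _
        · rw [hQ.isSelfAdjoint.star_eq, coIm_apply_left hQ hg]; exact Submodule.zero_mem _
      · refine ⟨fun g hg => ?_, fun g hg => ?_⟩
        · rw [coIm_apply_right hR hg]; exact Submodule.zero_mem _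
        · rw [hR.isSelfAdjoint.star_eq, coIm_apply_right hR hg]; exact Submodule.zero_mem _
    | algebraMap r =>
      refine ⟨fun g hg => ?_, fun g hg => ?_⟩
      · rw [Algebra.algebraMap_eq_smul_one]
        exact Submodule.smul_mem _ r hg
      · rw [Algebra.algebraMap_eq_smul_one, star_smul, star_one]
        exact Submodule.smul_mem _ (star r) hg
    | add x y _ _ hx hy =>
      refine ⟨fun g hg => Submodule.add_mem _ (hx.1 g hg) (hy.1 g hg), fun g hg => ?_⟩
      rw [star_add]
      exact Submodule.add_mem _ (hx.2 g hg) (hy.2 g hg)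
    | mul x y _ _ hx hy =>
      refine ⟨fun g hg => hx.1 _ (hy.1 g hg), fun g hg => ?_⟩
      rw [star_mul]
      exact hy.2 _ (hx.2 g hg)
    | star x _ hx =>
      refine ⟨hx.2, fun g hg => ?_⟩
      rw [star_star]
      exact hx.1 g hg
  have hcl : IsClosed {B : H →L[ℂ] H | B f ∈ coIm PQ PR} :=
    (isClosed_coIm PQ PR).preimage (ContinuousLinearMap.apply ℂ H f).continuous
  exact closure_minimal (fun B hB => (key B hB).1 f hf) hcl hA

/-- `O'(P_Q, P_R)`: the elements of `O(P_Q, P_R)` vanishing on `(Im P_Q)^⊥ ∩ (Im P_R)^⊥`. -/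
def idealO {PQ PR : H →L[ℂ] H} (hQ : IsStarProjection PQ) (hR : IsStarProjection PR) :
    NonUnitalStarSubalgebra ℂ (H →L[ℂ] H) where
  carrier := {A | A ∈ algO PQ PR ∧ ∀ f ∈ coIm PQ PR, A f = 0}
  add_mem' {A B} hA hB := ⟨add_mem hA.1 hB.1, fun f hf => by simp [hA.2 f hf, hB.2 f hf]⟩
  zero_mem' := ⟨zero_mem _, fun f _ => by simp⟩
  mul_mem' {A B} hA hB := ⟨mul_mem hA.1 hB.1, fun f hf => by
    simp [hB.2 f hf]⟩
  smul_mem' c A hA := ⟨SMulMemClass.smul_mem c hA.1, fun f hf => by simp [hA.2 f hf]⟩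
  star_mem' {A} hA := ⟨star_mem hA.1, fun f hf => by
    have h1 : A ((star A) f) = 0 := hA.2 _ (coIm_invariant hQ hR (star_mem hA.1) hf)
    have h2 : ⟪(star A) f, (star A) f⟫_ℂ = ⟪f, A ((star A) f)⟫_ℂ :=
      ContinuousLinearMap.adjoint_inner_left A _ _
    rw [h1, inner_zero_right] at h2
    exact inner_self_eq_zero.1 h2⟩

section

variable {PQ PR : H →L[ℂ] H} (hQ : IsStarProjection PQ) (hR : IsStarProjection PR)

/-- `O'` is a two-sided ideal of `O`. -/
theorem idealO_isIdeal {A B : H →L[ℂ] H} (hA : A ∈ algO PQ PR) (hB : B ∈ idealO hQ hR) :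
    A * B ∈ idealO hQ hR ∧ B * A ∈ idealO hQ hR :=
  ⟨⟨mul_mem hA hB.1, fun f hf => by simp [hB.2 f hf]⟩,
    ⟨mul_mem hB.1 hA, fun f hf => hB.2 _ (coIm_invariant hQ hR hA hf)⟩⟩

/-- `P_Q` as an element of `O(P_Q, P_R)`. -/
def genQ (PQ PR : H →L[ℂ] H) : algO PQ PR := ⟨PQ, PQ_mem_algO PQ PR⟩

/-- `P_R` as an element of `O(P_Q, P_R)`. -/
def genR (PQ PR : H →L[ℂ] H) : algO PQ PR := ⟨PR, PR_mem_algO PQ PR⟩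

/-- `P_Q` as an element of `O'(P_Q, P_R)`. -/
def genQ' : idealO hQ hR := ⟨PQ, PQ_mem_algO PQ PR, fun _ hf => coIm_apply_left hQ hf⟩

/-- `P_R` as an element of `O'(P_Q, P_R)`. -/
def genR' : idealO hQ hR := ⟨PR, PR_mem_algO PQ PR, fun _ hf => coIm_apply_right hR hf⟩

/-- The inclusion of `O'` into `O`. -/
def incl : idealO hQ hR →⋆ₙₐ[ℂ] algO PQ PR where
  toFun A := ⟨A.1, A.2.1⟩
  map_smul' _ _ := rfl
  map_zero' := rfl
  map_add' _ _ := rfl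
  map_mul' _ _ := rfl
  map_star' _ := rfl

/-- Restriction to `O'` of a unital representation of `O`. -/
def restrict {K : Type*} [NormedAddCommGroup K] [InnerProductSpace ℂ K] [CompleteSpace K]
    (π : algO PQ PR →⋆ₐ[ℂ] (K →L[ℂ] K)) : idealO hQ hR →⋆ₙₐ[ℂ] (K →L[ℂ] K) where
  toFun A := π (incl hQ hR A)
  map_smul' c A := by
    rw [map_smul, map_smul]; rfl
  map_zero' := by rw [map_zero, map_zero]
  map_add' A B := by rw [map_add, map_add]
  map_mul' A B := by rw [map_mul, map_mul]
  map_star' A := by rw [map_star, map_star]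

end

/-- The two-dimensional Hilbert space `ℂ²`. -/
abbrev C2 : Type := EuclideanSpace ℂ (Fin 2)

/-- The value at `p` of the matrix function representing `P_Q`. -/
def matQ (p : ℝ) : Matrix (Fin 2) (Fin 2) ℂ :=
  !![((1 - p : ℝ) : ℂ), ((Real.sqrt (p * (1 - p)) : ℝ) : ℂ);
     ((Real.sqrt (p * (1 - p)) : ℝ) : ℂ), ((p : ℝ) : ℂ)]

/-- The (constant) value of the matrix function representing `P_R`. -/
def matR : Matrix (Fin 2) (Fin 2) ℂ := !![1, 0; 0, 0]

/-- `π` is the representation of `O(P_Q, P_R)` at the parameter `p`: the unital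
`*`-representation on `ℂ²` sending `P_Q` and `P_R` to the values at `p` of their matrix
functions. -/
def IsRepAt {PQ PR : H →L[ℂ] H} (p : ℝ) (π : algO PQ PR →⋆ₐ[ℂ] (C2 →L[ℂ] C2)) : Prop :=
  π (genQ PQ PR) = Matrix.toEuclideanCLM (n := Fin 2) (𝕜 := ℂ) (matQ p) ∧
  π (genR PQ PR) = Matrix.toEuclideanCLM (n := Fin 2) (𝕜 := ℂ) matR

section

variable {𝓐 : Type*} [NonUnitalSemiring 𝓐] [Star 𝓐] [Module ℂ 𝓐]
variable {K K₁ K₂ : Type*} [NormedAddCommGroup K] [InnerProductSpace ℂ K] [CompleteSpace K]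
  [NormedAddCommGroup K₁] [InnerProductSpace ℂ K₁] [CompleteSpace K₁]
  [NormedAddCommGroup K₂] [InnerProductSpace ℂ K₂] [CompleteSpace K₂]

/-- A representation is irreducible if it is nonzero and the only closed invariant subspaces are
the trivial ones. -/
def IsIrreducible (ρ : 𝓐 →⋆ₙₐ[ℂ] (K →L[ℂ] K)) : Prop :=
  (∃ a, ρ a ≠ 0) ∧
    ∀ V : Submodule ℂ K, IsClosed (V : Set K) → (∀ a, ∀ x ∈ V, ρ a x ∈ V) → V = ⊥ ∨ V = ⊤

/-- `ρ` is unitarily equivalent to the Hilbert space direct sum `ρ₁ ⊕ ρ₂`. -/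
def IsDirectSum (ρ : 𝓐 →⋆ₙₐ[ℂ] (K →L[ℂ] K)) (ρ₁ : 𝓐 →⋆ₙₐ[ℂ] (K₁ →L[ℂ] K₁))
    (ρ₂ : 𝓐 →⋆ₙₐ[ℂ] (K₂ →L[ℂ] K₂)) : Prop :=
  ∃ U : K ≃ₗᵢ[ℂ] WithLp 2 (K₁ × K₂), ∀ (a : 𝓐) (x : K),
    U (ρ a x) = WithLp.toLp 2 (ρ₁ a (U x).fst, ρ₂ a (U x).snd)

end

end TwoProjections

end

open scoped InnerProductSpace

noncomputable section

namespace TwoProjections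

/-! The operator `D = (PQ - PR) ^ 2` commutes with both projections, and the compression of `PQ` to
the range of `PR` is `1 - D`. If `0 < p < 1` lies in the spectrum of `D`, there are unit vectors `e
n` in the range of `PR` that are approximate eigenvectors of `D` at `p`. Such a vector and the
normalised remaining part of `PQ (e n)` span a nearly isometric copy of `ℂ²` on which the two
projections act almost as `matQ p` and `matR` (`hasSpinorApprox_of_mem_spectrum`). Since `matQ` is
continuous in `p`, the endpoints follow by closedness.

Nearly isometric maps that asymptotically intertwine `A` with `M` determine `M` and force `‖M‖ ≤
‖A‖`. So the assignment of matrices to generators extends to the norm closure as a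
`*`-representation (`exists_starAlgHom_of_asympIntertwines`). Uniqueness is density plus automatic
continuity.

For `0 < p < 1` the two matrices generate all matrix units. At the endpoints they commute, so the
image is diagonal and splits into its two entries. At `p = 0` an element `a` of the algebra acts on
the common kernel as multiplication by its second diagonal entry, which therefore vanishes on the
ideal once that kernel is nonzero. -/

variable {H : Type*} [NormedAddCommGroup H] [InnerProductSpace ℂ H] [CompleteSpace H]

open Filter Topology

set_option linter.unusedSectionVars false

/-! ### Representations induced by asymptotically isometric maps -/

section Extension

variable {K : Type*} [NormedAddCommGroup K] [InnerProductSpace ℂ K] [CompleteSpace K]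

/-- The maps `T n` asymptotically intertwine `A` and `M`. -/
def AsympIntertwines (T : ℕ → K →L[ℂ] H) (A : H →L[ℂ] H) (M : K →L[ℂ] K) : Prop :=
  Tendsto (fun n => A ∘L T n - T n ∘L M) atTop (𝓝 0)

/-- The maps `T n` are asymptotically isometric. -/
def AsympIsometric (T : ℕ → K →L[ℂ] H) : Prop :=
  Tendsto (fun n => ContinuousLinearMap.adjoint (T n) ∘L T n) atTop (𝓝 1)

variable {T : ℕ → K →L[ℂ] H} {A B : H →L[ℂ] H} {M N : K →L[ℂ] K}

theorem AsympIsometric.tendsto_norm (hT : AsympIsometric T) :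
    Tendsto (fun n => ‖T n‖) atTop (𝓝 (Real.sqrt ‖(1 : K →L[ℂ] K)‖)) := by
  have h := (Real.continuous_sqrt.tendsto _).comp hT.norm
  refine h.congr fun n => ?_
  simp only [Function.comp, ContinuousLinearMap.norm_adjoint_comp_self]
  exact Real.sqrt_mul_self (norm_nonneg _)

/-- Write `T* A T = T* (A T - T M) + (T* T) M`; the norms of `T n` are bounded, so the first term
vanishes in the limit. Uniqueness of `M` and the bound on its norm both come from this. -/
theorem AsympIntertwines.tendsto_compression (hT : AsympIsometric T)
    (h : AsympIntertwines T A M) :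
    Tendsto (fun n => ContinuousLinearMap.adjoint (T n) ∘L (A ∘L T n)) atTop (𝓝 M) := by
  have h1 : Tendsto (fun n => ContinuousLinearMap.adjoint (T n) ∘L (A ∘L T n - T n ∘L M))
      atTop (𝓝 0) := by
    have h2 : Tendsto (fun n => ‖T n‖ * ‖A ∘L T n - T n ∘L M‖) atTop (𝓝 0) := by
      simpa using hT.tendsto_norm.mul h.norm
    refine squeeze_zero_norm (fun n => ?_) h2
    refine (ContinuousLinearMap.opNorm_comp_le _ _).trans_eq ?_
    rw [LinearIsometryEquiv.norm_map]
  have h3 : Tendsto (fun n => (ContinuousLinearMap.adjoint (T n) ∘L T n) * M) atTop (𝓝 (1 * M)) :=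
    hT.mul_const M
  have h4 := h1.add h3
  rw [one_mul, zero_add] at h4
  refine h4.congr fun n => ?_
  ext x
  simp

theorem AsympIntertwines.unique (hT : AsympIsometric T)
    (h : AsympIntertwines T A M) (h' : AsympIntertwines T A N) : M = N :=
  tendsto_nhds_unique (h.tendsto_compression hT) (h'.tendsto_compression hT)

theorem AsympIntertwines.norm_le (hT : AsympIsometric T)
    (h : AsympIntertwines T A M) : ‖M‖ ≤ ‖A‖ := by
  have h1 : Tendsto (fun n => ‖ContinuousLinearMap.adjoint (T n) ∘L T n‖ * ‖A‖) atTop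
      (𝓝 (‖(1 : K →L[ℂ] K)‖ * ‖A‖)) := hT.norm.mul_const _
  have h2 : ‖M‖ ≤ ‖(1 : K →L[ℂ] K)‖ * ‖A‖ := by
    refine le_of_tendsto_of_tendsto' (h.tendsto_compression hT).norm h1 fun n => ?_
    refine (ContinuousLinearMap.opNorm_comp_le _ _).trans ?_
    rw [LinearIsometryEquiv.norm_map, ContinuousLinearMap.norm_adjoint_comp_self, mul_assoc,
      mul_comm ‖T n‖ ‖A‖]
    exact mul_le_mul_of_nonneg_left (ContinuousLinearMap.opNorm_comp_le _ _) (norm_nonneg _)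
  -- Only `‖1‖ ≤ 1` is used, so `K` may be zero.
  exact h2.trans (mul_le_of_le_one_left (norm_nonneg _) ContinuousLinearMap.norm_id_le)

theorem AsympIntertwines.add (h : AsympIntertwines T A M) (h' : AsympIntertwines T B N) :
    AsympIntertwines T (A + B) (M + N) := by
  have := Tendsto.add h h'
  rw [add_zero] at this
  refine this.congr fun n => ?_
  ext x
  simp
  abel

theorem AsympIntertwines.sub (h : AsympIntertwines T A M) (h' : AsympIntertwines T B N) :
    AsympIntertwines T (A - B) (M - N) := by
  have := Tendsto.sub h h'
  rw [sub_zero] at this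
  refine this.congr fun n => ?_
  ext x
  simp
  abel

theorem AsympIntertwines.algebraMap (T : ℕ → K →L[ℂ] H) (c : ℂ) :
    AsympIntertwines T (algebraMap ℂ _ c) (algebraMap ℂ _ c) := by
  refine tendsto_const_nhds.congr fun n => ?_
  ext x
  simp [Algebra.algebraMap_eq_smul_one]

theorem AsympIntertwines.mul (h : AsympIntertwines T A M) (h' : AsympIntertwines T B N) :
    AsympIntertwines T (A * B) (M * N) := by
  have h1 : Tendsto (fun n => A ∘L (B ∘L T n - T n ∘L N)) atTop (𝓝 (A ∘L 0)) :=
    ((ContinuousLinearMap.compL ℂ K H H A).continuous.tendsto _).comp h'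
  have h2 : Tendsto (fun n => (A ∘L T n - T n ∘L M) ∘L N) atTop (𝓝 (0 ∘L N)) :=
    (((ContinuousLinearMap.compL ℂ K K H).flip N).continuous.tendsto _).comp h
  have := h1.add h2
  simp only [ContinuousLinearMap.comp_zero, ContinuousLinearMap.zero_comp, add_zero] at this
  refine this.congr fun n => ?_
  ext x
  simp

/-- The uniform bound on `‖T n‖` makes the error of replacing `A`, `M` by `A' k`, `M' k` small
uniformly in `n`. -/
theorem AsympIntertwines.of_tendsto (hT : AsympIsometric T) {A' : ℕ → H →L[ℂ] H}
    {M' : ℕ → K →L[ℂ] K} (h : ∀ k, AsympIntertwines T (A' k) (M' k))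
    (hA : Tendsto A' atTop (𝓝 A)) (hM : Tendsto M' atTop (𝓝 M)) : AsympIntertwines T A M := by
  obtain ⟨C, hC⟩ := hT.tendsto_norm.bddAbove_range
  have hC' : ∀ n, ‖T n‖ ≤ C := fun n => hC ⟨n, rfl⟩
  rw [AsympIntertwines, Metric.tendsto_atTop]
  intro ε hε
  have h1 : Tendsto (fun k => ‖A - A' k‖ * C + C * ‖M' k - M‖) atTop (𝓝 0) := by
    have a1 : Tendsto (fun k => ‖A - A' k‖) atTop (𝓝 0) := by
      simpa using (hA.const_sub A).norm
    have a2 : Tendsto (fun k => ‖M' k - M‖) atTop (𝓝 0) := by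
      simpa using (hM.sub_const M).norm
    simpa using (a1.mul_const C).add (a2.const_mul C)
  obtain ⟨k, hk⟩ := (h1.eventually (gt_mem_nhds (half_pos hε))).exists
  obtain ⟨n₀, hn₀⟩ := (Metric.tendsto_atTop.1 (h k)) (ε / 2) (half_pos hε)
  refine ⟨n₀, fun n hn => ?_⟩
  have h2 := hn₀ n hn
  rw [dist_zero_right] at h2 ⊢
  have h3 : A ∘L T n - T n ∘L M =
      ((A - A' k) ∘L T n + T n ∘L (M' k - M)) + (A' k ∘L T n - T n ∘L M' k) := by
    ext x
    simp
    abel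
  have h4 : ‖(A - A' k) ∘L T n‖ ≤ ‖A - A' k‖ * C :=
    (ContinuousLinearMap.opNorm_comp_le _ _).trans
      (mul_le_mul_of_nonneg_left (hC' n) (norm_nonneg _))
  have h5 : ‖T n ∘L (M' k - M)‖ ≤ C * ‖M' k - M‖ :=
    (ContinuousLinearMap.opNorm_comp_le _ _).trans
      (mul_le_mul_of_nonneg_right (hC' n) (norm_nonneg _))
  rw [h3]
  refine (norm_add_le _ _).trans_lt ?_
  have := norm_add_le ((A - A' k) ∘L T n) (T n ∘L (M' k - M))
  linarith

variable {PQ PR : H →L[ℂ] H} {MQ MR : K →L[ℂ] K}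

/-- The adjoint is carried along because intertwining `A` with `M` does not by itself give the same
for the adjoints. -/
theorem exists_asympIntertwines (hT : AsympIsometric T)
    (sQ : IsSelfAdjoint PQ) (sR : IsSelfAdjoint PR) (sMQ : IsSelfAdjoint MQ)
    (sMR : IsSelfAdjoint MR) (hQ : AsympIntertwines T PQ MQ) (hR : AsympIntertwines T PR MR)
    (hA : A ∈ algO PQ PR) :
    ∃ M, AsympIntertwines T A M ∧ AsympIntertwines T (star A) (star M) := by
  have key : ∀ B ∈ StarAlgebra.adjoin ℂ ({PQ, PR} : Set (H →L[ℂ] H)),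
      ∃ M, AsympIntertwines T B M ∧ AsympIntertwines T (star B) (star M) := by
    intro B hB
    induction hB using StarAlgebra.adjoin_induction with
    | mem x hx =>
      rcases hx with rfl | rfl
      · exact ⟨MQ, hQ, by rwa [sQ.star_eq, sMQ.star_eq]⟩
      · exact ⟨MR, hR, by rwa [sR.star_eq, sMR.star_eq]⟩
    | algebraMap r =>
      refine ⟨_, .algebraMap T r, ?_⟩
      rw [← algebraMap_star_comm, ← algebraMap_star_comm]
      exact .algebraMap T _
    | add x y _ _ hx hy =>
      obtain ⟨M, h1, h2⟩ := hx
      obtain ⟨N, h3, h4⟩ := hy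
      exact ⟨M + N, h1.add h3, by rw [star_add, star_add]; exact h2.add h4⟩
    | mul x y _ _ hx hy =>
      obtain ⟨M, h1, h2⟩ := hx
      obtain ⟨N, h3, h4⟩ := hy
      exact ⟨M * N, h1.mul h3, by rw [star_mul, star_mul]; exact h4.mul h2⟩
    | star x _ hx =>
      obtain ⟨M, h1, h2⟩ := hx
      exact ⟨star M, h2, by rwa [star_star, star_star]⟩
  obtain ⟨A', hA', hlim⟩ := mem_closure_iff_seq_limit.1 hA
  choose M' h1 h2 using fun k => key (A' k) (hA' k)
  -- Differences are intertwined too, so `norm_le` bounds `‖M' m - M' n‖` by `‖A' m - A' n‖`.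
  have hcau : CauchySeq M' := by
    have := hlim.cauchySeq
    rw [Metric.cauchySeq_iff] at this ⊢
    intro ε hε
    obtain ⟨n₀, hn₀⟩ := this ε hε
    refine ⟨n₀, fun m hm n hn => (hn₀ m hm n hn).trans_le' ?_⟩
    rw [dist_eq_norm, dist_eq_norm]
    exact ((h1 m).sub (h1 n)).norm_le hT
  obtain ⟨M, hM⟩ := cauchySeq_tendsto_of_complete hcau
  exact ⟨M, .of_tendsto hT h1 hlim hM,
    .of_tendsto hT h2 ((continuous_star.tendsto _).comp hlim) ((continuous_star.tendsto _).comp hM)⟩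

/-- Asymptotically isometric maps intertwining the generators of `O(P_Q, P_R)` with operators
on `K` induce a representation on `K`. -/
theorem exists_starAlgHom_of_asympIntertwines (hT : AsympIsometric T)
    (sQ : IsSelfAdjoint PQ) (sR : IsSelfAdjoint PR) (sMQ : IsSelfAdjoint MQ)
    (sMR : IsSelfAdjoint MR) (hQ : AsympIntertwines T PQ MQ) (hR : AsympIntertwines T PR MR) :
    ∃ π : algO PQ PR →⋆ₐ[ℂ] (K →L[ℂ] K), π (genQ PQ PR) = MQ ∧ π (genR PQ PR) = MR := by
  choose F h1 h2 using fun A : algO PQ PR =>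
    exists_asympIntertwines hT sQ sR sMQ sMR hQ hR A.2
  -- Each algebraic law holds because both sides are intertwined with the same operator.
  refine ⟨{ toFun := F, map_one' := ?_, map_mul' := ?_, map_zero' := ?_, map_add' := ?_,
            commutes' := ?_, map_star' := ?_ }, (h1 _).unique hT hQ, (h1 _).unique hT hR⟩
  · refine (h1 _).unique hT ?_
    simpa using AsympIntertwines.algebraMap T 1
  · exact fun A B => (h1 _).unique hT ((h1 A).mul (h1 B))
  · refine (h1 _).unique hT ?_
    simpa using AsympIntertwines.algebraMap T 0
  · exact fun A B => (h1 _).unique hT ((h1 A).add (h1 B))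
  · exact fun c => (h1 _).unique hT (.algebraMap T c)
  · exact fun A => (h1 _).unique hT (h2 A)

end Extension

/-! ### Approximate eigenvectors in the range of `PR` -/

section ApproximateEigenvectors

/-- `⟪S² x, x⟫ = ‖S x‖² ≥ c² ‖x‖²` makes `S²` invertible, hence also its factor `S`. -/
theorem isUnit_of_isSelfAdjoint_of_bounded_below {S : H →L[ℂ] H} (hS : IsSelfAdjoint S) {c : ℝ}
    (hc : 0 < c) (h : ∀ f, c * ‖f‖ ≤ ‖S f‖) : IsUnit S := by
  have h2 : IsUnit (S * S) := by
    refine ContinuousLinearMap.isUnit_of_forall_le_norm_inner_map (S * S)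
      (c := ⟨c ^ 2, sq_nonneg c⟩) (by exact_mod_cast pow_pos hc 2) fun x => ?_
    have h3 : ⟪(S * S) x, x⟫_ℂ = ⟪S x, S x⟫_ℂ := by
      have := ContinuousLinearMap.adjoint_inner_left S x (S x)
      rwa [hS.adjoint_eq] at this
    rw [h3, inner_self_eq_norm_sq_to_K, norm_pow]
    simp only [RCLike.norm_ofReal, abs_norm]
    calc ‖x‖ ^ 2 * c ^ 2 = (c * ‖x‖) ^ 2 := by ring
      _ ≤ ‖S x‖ ^ 2 := pow_le_pow_left₀ (by positivity) (h x) 2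
  exact ((Commute.refl S).isUnit_mul_iff.1 h2).1

theorem exists_seq_of_mem_spectrum {S : H →L[ℂ] H} (hS : IsSelfAdjoint S) {p : ℝ}
    (hp : (p : ℂ) ∈ spectrum ℂ S) :
    ∃ f : ℕ → H, (∀ n, ‖f n‖ = 1) ∧ Tendsto (fun n => S (f n) - (p : ℂ) • f n) atTop (𝓝 0) := by
  have key : ∀ n : ℕ, ∃ f : H, ‖f‖ = 1 ∧ ‖S f - (p : ℂ) • f‖ ≤ 1 / ((n : ℝ) + 1) := by
    intro n
    by_contra! hcon
    apply hp
    have hsa : IsSelfAdjoint (algebraMap ℂ (H →L[ℂ] H) p - S) := by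
      refine IsSelfAdjoint.sub ?_ hS
      rw [IsSelfAdjoint, ← algebraMap_star_comm]
      simp
    refine isUnit_of_isSelfAdjoint_of_bounded_below hsa (c := 1 / ((n : ℝ) + 1)) (by positivity)
      fun f => ?_
    rcases eq_or_ne f 0 with rfl | hf
    · simp
    have hf' : 0 < ‖f‖ := norm_pos_iff.2 hf
    have h1 := (hcon (((‖f‖⁻¹ : ℝ) : ℂ) • f)
      (by rw [norm_smul]; simp [hf'.ne'])).le
    rw [map_smul, smul_comm, ← smul_sub, norm_smul, Complex.norm_real, norm_inv, norm_norm,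
      inv_mul_eq_div, le_div_iff₀ hf'] at h1
    rw [sub_apply, Algebra.algebraMap_eq_smul_one, norm_sub_rev]
    exact h1
  choose f h1 h2 using key
  exact ⟨f, h1, squeeze_zero_norm h2 tendsto_one_div_add_atTop_nhds_zero_nat⟩

variable {PQ PR : H →L[ℂ] H}

/-- This makes `⟪e, PQ e⟫` close to `1 - p` for an approximate eigenvector `e` of `D` in the range
of `PR`. -/
theorem proj_mul_sq_sub_mul_proj (hQ : IsStarProjection PQ) (hR : IsStarProjection PR) :
    PR * PQ * PR = PR - PR * (PQ - PR) ^ 2 := by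
  have q := hQ.isIdempotentElem.eq
  have r := hR.isIdempotentElem.eq
  have : PR * (PQ - PR) ^ 2 = PR * (PQ * PQ) - PR * PQ * PR - (PR * PR) * PQ + PR * PR * PR := by
    noncomm_ring
  rw [this, q, r, r]
  abel

theorem commute_sq_sub_left (hQ : IsStarProjection PQ) (hR : IsStarProjection PR) :
    (PQ - PR) ^ 2 * PQ = PQ * (PQ - PR) ^ 2 := by
  have q := hQ.isIdempotentElem.eq
  have r := hR.isIdempotentElem.eq
  have h1 : (PQ - PR) ^ 2 * PQ = (PQ * PQ) * PQ - PQ * PR * PQ - PR * (PQ * PQ) + PR * PR * PQ := by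
    noncomm_ring
  have h2 : PQ * (PQ - PR) ^ 2 = (PQ * PQ) * PQ - (PQ * PQ) * PR - PQ * PR * PQ + PQ * (PR * PR) := by
    noncomm_ring
  rw [h1, h2, r, q, q]
  abel

theorem commute_sq_sub_right (hQ : IsStarProjection PQ) (hR : IsStarProjection PR) :
    (PQ - PR) ^ 2 * PR = PR * (PQ - PR) ^ 2 := by
  have := commute_sq_sub_left hR hQ
  rwa [show (PR - PQ) ^ 2 = (PQ - PR) ^ 2 by noncomm_ring] at this

theorem norm_apply_le_of_isStarProjection {P : H →L[ℂ] H} (hP : IsStarProjection P) (x : H) :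
    ‖P x‖ ≤ ‖x‖ :=
  (P.le_opNorm x).trans (mul_le_of_le_one_left (norm_nonneg _) hP.norm_le)

/-- A spectral value `p` in `(0, 1)` of `(P_Q - P_R)^2` has approximate eigenvectors in the range
of `P_R`. -/
theorem exists_seq_in_range (hQ : IsStarProjection PQ) (hR : IsStarProjection PR)
    {p : ℝ} (hp0 : 0 < p) (hp1 : p < 1) (hp : (p : ℂ) ∈ spectrum ℂ ((PQ - PR) ^ 2)) :
    ∃ e : ℕ → H, (∀ n, PR (e n) = e n) ∧ (∀ n, ‖e n‖ = 1) ∧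
      Tendsto (fun n => ((PQ - PR) ^ 2) (e n) - (p : ℂ) • e n) atTop (𝓝 0) := by
  set D := (PQ - PR) ^ 2 with hD
  have hDsa : IsSelfAdjoint D := (hQ.isSelfAdjoint.sub hR.isSelfAdjoint).pow 2
  obtain ⟨f, hf1, hf⟩ := exists_seq_of_mem_spectrum hDsa hp
  have cQ : ∀ x, D (PQ x) = PQ (D x) := fun x => congrArg (· x) (commute_sq_sub_left hQ hR)
  have cR : ∀ x, D (PR x) = PR (D x) := fun x => congrArg (· x) (commute_sq_sub_right hQ hR)
  have iQ : ∀ x, PQ (PQ x) = PQ x := fun x => congrArg (· x) hQ.isIdempotentElem.eq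
  have iR : ∀ x, PR (PR x) = PR x := fun x => congrArg (· x) hR.isIdempotentElem.eq
  have key : ∀ n : ℕ, ∃ e, PR e = e ∧ ‖e‖ = 1 ∧ ‖D e - (p : ℂ) • e‖ ≤ 1 / ((n : ℝ) + 1) := by
    intro n
    -- Otherwise `D - p` is bounded below on the range of `PR`; this will force `f k → 0`.
    by_contra! hcon
    have hb : ∀ e, PR e = e → ‖e‖ ≤ ((n : ℝ) + 1) * ‖D e - (p : ℂ) • e‖ := by
      intro e he
      rcases eq_or_ne e 0 with rfl | hf
      · simp
      have hf' : 0 < ‖e‖ := norm_pos_iff.2 hf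
      have h1 := (hcon (((‖e‖⁻¹ : ℝ) : ℂ) • e) (by rw [map_smul, he])
        (by rw [norm_smul]; simp [hf'.ne'])).le
      rw [map_smul, smul_comm, ← smul_sub, norm_smul, Complex.norm_real, norm_inv, norm_norm,
        inv_mul_eq_div, div_le_div_iff₀ (by positivity) hf'] at h1
      linarith
    have hlim : ∀ A : H →L[ℂ] H, Tendsto (fun n => A (D (f n) - (p : ℂ) • f n)) atTop (𝓝 0) := by
      intro A
      have := (A.continuous.tendsto 0).comp hf
      rwa [map_zero] at this
    -- If `A` commutes with `D` and maps into the range of `PR`, the lower bound applied to `A (f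
    -- k)` is controlled by `A ((D - p) (f k))`.
    have small : ∀ A : H →L[ℂ] H, (∀ x, D (A x) = A (D x)) → (∀ x, PR (A x) = A x) →
        Tendsto (fun k => A (f k)) atTop (𝓝 0) := by
      intro A hA hA'
      have h1 := (hlim A).norm.const_mul ((n : ℝ) + 1)
      rw [norm_zero, mul_zero] at h1
      refine squeeze_zero_norm (fun k => ?_) h1
      refine (hb _ (hA' _)).trans_eq ?_
      rw [hA, map_sub, map_smul]
    have s1 := small PR cR iR
    have s2 := small (PR * PQ * (1 - PR)) (fun x => by simp [cQ, cR]) (fun x => by simp [iR])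
    have s3 : Tendsto (fun k => (1 - D - PQ) ((PR * PQ * (1 - PR)) (f k))) atTop (𝓝 0) := by
      have := ((1 - D - PQ).continuous.tendsto 0).comp s2
      rwa [map_zero] at this
    -- Since `D (D - 1) = (D + p - 1) (D - p) + p (p - 1)`, subtracting this limit from `s3` leaves
    -- `p (p - 1) (1 - PR) (f k)`. Its coefficient is nonzero for `0 < p < 1`.
    have s4 := hlim (((p : ℂ) • 1 + D - 1) * (1 - PR))
    -- on the kernel of `PR`, `D * (D - 1)` is controlled by the corner `PR * PQ`
    have alg : D * (D - 1) * (1 - PR) = (1 - D - PQ) * (PR * PQ * (1 - PR)) := by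
      have Dx : ∀ x, D x = PQ x - PQ (PR x) - PR (PQ x) + PR x := by
        intro x
        simp only [hD, sq, mul_apply_eq_comp, sub_apply, map_sub, iQ, iR]
        abel
      ext x
      simp [Dx, iQ, iR]
      abel
    have s5 : Tendsto (fun k => ((p : ℂ) * (p - 1)) • (f k - PR (f k))) atTop (𝓝 0) := by
      have := s3.sub s4
      rw [sub_zero] at this
      refine this.congr fun k => ?_
      have h1 := congrArg (· (f k)) alg
      simp only [mul_apply_eq_comp] at h1 ⊢
      rw [← h1]
      simp [cR]
      module
    have hne : (p : ℂ) * (p - 1) ≠ 0 := by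
      refine mul_ne_zero (by exact_mod_cast hp0.ne') ?_
      rw [sub_ne_zero]
      exact_mod_cast hp1.ne
    have s6 : Tendsto f atTop (𝓝 0) := by
      have := (s5.const_smul ((p : ℂ) * (p - 1))⁻¹).add s1
      rw [smul_zero, add_zero] at this
      refine this.congr fun k => ?_
      rw [smul_smul, inv_mul_cancel₀ hne, one_smul, sub_add_cancel]
    have s7 := s6.norm
    simp only [hf1, norm_zero] at s7
    exact one_ne_zero (tendsto_nhds_unique tendsto_const_nhds s7)
  choose e h1 h2 h3 using key
  exact ⟨e, h1, h2, squeeze_zero_norm h3 tendsto_one_div_add_atTop_nhds_zero_nat⟩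

end ApproximateEigenvectors

/-! ### Maps from `ℂ²` and Gram matrices -/

section SpinorMaps

/-- The linear map `ℂ² → H` sending the standard basis to `u`, `v`. -/
def pairMap (u v : H) : C2 →L[ℂ] H :=
  (EuclideanSpace.proj (0 : Fin 2) : C2 →L[ℂ] ℂ).smulRight u +
    (EuclideanSpace.proj (1 : Fin 2) : C2 →L[ℂ] ℂ).smulRight v

theorem pairMap_apply (u v : H) (x : C2) : pairMap u v x = x 0 • u + x 1 • v := rfl

/-- The operator on `ℂ²` with a given matrix. -/
abbrev toOp : Matrix (Fin 2) (Fin 2) ℂ ≃⋆ₐ[ℂ] (C2 →L[ℂ] C2) :=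
  Matrix.toEuclideanCLM (n := Fin 2) (𝕜 := ℂ)

theorem toOp_apply_zero (m : Matrix (Fin 2) (Fin 2) ℂ) (x : C2) :
    toOp m x 0 = m 0 0 * x 0 + m 0 1 * x 1 := by
  rw [toOp, Matrix.ofLp_toEuclideanCLM]
  simp [Matrix.mulVec, dotProduct, Fin.sum_univ_two]

theorem toOp_apply_one (m : Matrix (Fin 2) (Fin 2) ℂ) (x : C2) :
    toOp m x 1 = m 1 0 * x 0 + m 1 1 * x 1 := by
  rw [toOp, Matrix.ofLp_toEuclideanCLM]
  simp [Matrix.mulVec, dotProduct, Fin.sum_univ_two]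

theorem continuous_toOp : Continuous toOp :=
  LinearMap.continuous_of_finiteDimensional (toOp.toAlgEquiv.toLinearMap)

theorem adjoint_pairMap_comp (u v : H) :
    ContinuousLinearMap.adjoint (pairMap u v) ∘L pairMap u v =
      toOp !![⟪u, u⟫_ℂ, ⟪u, v⟫_ℂ; ⟪v, u⟫_ℂ, ⟪v, v⟫_ℂ] := by
  refine ContinuousLinearMap.ext fun x => ext_inner_left ℂ fun y => ?_
  rw [ContinuousLinearMap.comp_apply, ContinuousLinearMap.adjoint_inner_right]
  simp only [pairMap_apply, PiLp.inner_apply, Fin.sum_univ_two, toOp_apply_zero, toOp_apply_one]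
  simp [inner_add_left, inner_add_right, inner_smul_left, inner_smul_right]
  ring

end SpinorMaps

/-! ### Existence of the representation at every parameter -/

section SpinorExistence

variable {PQ PR : H →L[ℂ] H}

theorem norm_pairMap_zero_le (w : H) : ‖pairMap 0 w‖ ≤ ‖w‖ := by
  refine ContinuousLinearMap.opNorm_le_bound _ (norm_nonneg _) fun x => ?_
  rw [pairMap_apply, smul_zero, zero_add, norm_smul, mul_comm]
  exact mul_le_mul_of_nonneg_left (PiLp.norm_apply_le x 1) (norm_nonneg _)

theorem isSelfAdjoint_matQ (p : ℝ) : IsSelfAdjoint (matQ p) := by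
  ext i j
  fin_cases i <;> fin_cases j <;> simp [matQ]

theorem isSelfAdjoint_matR : IsSelfAdjoint matR := by
  ext i j
  fin_cases i <;> fin_cases j <;> simp [matR]

theorem continuous_matQ : Continuous matQ := by
  refine continuous_matrix fun i j => ?_
  fin_cases i <;> fin_cases j <;> simp [matQ] <;> fun_prop

/-- The pair `(P_Q, P_R)` is approximated, by nearly isometric maps from `ℂ²`, by the matrices
at the parameter `p`. -/
def HasSpinorApprox (PQ PR : H →L[ℂ] H) (p : ℝ) : Prop :=
  ∀ ε > 0, ∃ T : C2 →L[ℂ] H, ‖ContinuousLinearMap.adjoint T ∘L T - 1‖ < ε ∧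
    ‖PQ ∘L T - T ∘L toOp (matQ p)‖ < ε ∧ ‖PR ∘L T - T ∘L toOp matR‖ < ε

/-- A map that works for a nearby `q` works for `p`, by continuity of `matQ`. This reaches the
endpoints, where the direct construction would divide by `sqrt (p * (1 - p)) = 0`. -/
theorem isClosed_hasSpinorApprox (PQ PR : H →L[ℂ] H) : IsClosed {p | HasSpinorApprox PQ PR p} := by
  refine isClosed_of_closure_subset fun p hp ε hε => ?_
  have hc : ContinuousAt (fun q => toOp (matQ q)) p :=
    (continuous_toOp.comp continuous_matQ).continuousAt
  obtain ⟨δ, hδ, hball⟩ := Metric.continuousAt_iff.1 hc (ε / 4) (by positivity)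
  obtain ⟨q, hq, hpq⟩ := Metric.mem_closure_iff.1 hp δ hδ
  -- The bound by `1` gives `‖T‖² ≤ 2`, hence `‖T‖ ≤ 2`; then replacing `q` by `p` costs at most `2
  -- * (ε / 4)`.
  obtain ⟨T, h1, h2, h3⟩ := hq (min (ε / 2) 1) (by positivity)
  have hT : ‖T‖ ≤ 2 := by
    have a1 : ‖ContinuousLinearMap.adjoint T ∘L T‖ ≤ 2 := by
      have := norm_le_norm_add_norm_sub' (ContinuousLinearMap.adjoint T ∘L T) 1
      have a3 : ‖(1 : C2 →L[ℂ] C2)‖ ≤ 1 := ContinuousLinearMap.norm_id_le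
      have a2 := h1.trans_le (min_le_right _ _)
      linarith
    rw [ContinuousLinearMap.norm_adjoint_comp_self] at a1
    nlinarith [norm_nonneg T]
  have hqp := hball (by rwa [dist_comm] at hpq : dist q p < δ)
  rw [dist_eq_norm] at hqp
  refine ⟨T, h1.trans_le ((min_le_left _ _).trans (by linarith)), ?_,
    h3.trans_le ((min_le_left _ _).trans (by linarith))⟩
  have e1 : PQ ∘L T - T ∘L toOp (matQ p) =
      (PQ ∘L T - T ∘L toOp (matQ q)) + T ∘L (toOp (matQ q) - toOp (matQ p)) := by
    rw [ContinuousLinearMap.comp_sub]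
    abel
  rw [e1]
  have e2 : ‖T ∘L (toOp (matQ q) - toOp (matQ p))‖ ≤ 2 * (ε / 4) :=
    (ContinuousLinearMap.opNorm_comp_le _ _).trans
      (mul_le_mul hT hqp.le (norm_nonneg _) zero_le_two)
  have e3 := h2.trans_le (min_le_left _ _)
  refine (norm_add_le _ _).trans_lt ?_
  linarith

theorem hasSpinorApprox_of_mem_spectrum (hQ : IsStarProjection PQ) (hR : IsStarProjection PR)
    {p : ℝ} (hp0 : 0 < p) (hp1 : p < 1) (hp : (p : ℂ) ∈ spectrum ℂ ((PQ - PR) ^ 2)) :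
    HasSpinorApprox PQ PR p := by
  obtain ⟨e, he, hn, hlim⟩ := exists_seq_in_range hQ hR hp0 hp1 hp
  set D := (PQ - PR) ^ 2 with hD
  have iQ : ∀ x, PQ (PQ x) = PQ x := fun x => congrArg (· x) hQ.isIdempotentElem.eq
  have sQ : ∀ x y, ⟪PQ x, y⟫_ℂ = ⟪x, PQ y⟫_ℂ := fun x y => by
    have := ContinuousLinearMap.adjoint_inner_left PQ y x
    rwa [hQ.isSelfAdjoint.adjoint_eq] at this
  have sR : ∀ x y, ⟪PR x, y⟫_ℂ = ⟪x, PR y⟫_ℂ := fun x y => by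
    have := ContinuousLinearMap.adjoint_inner_left PR y x
    rwa [hR.isSelfAdjoint.adjoint_eq] at this
  set s : ℂ := ((Real.sqrt (p * (1 - p)) : ℝ) : ℂ) with hs
  have hpp : 0 < p * (1 - p) := mul_pos hp0 (by linarith)
  have hss : s * s = p * (1 - p) := by
    rw [hs, ← Complex.ofReal_mul, Real.mul_self_sqrt hpp.le]
    push_cast
    ring
  have hs0 : s ≠ 0 := by
    rw [hs]
    exact_mod_cast (Real.sqrt_pos.2 hpp).ne'
  have hsc : (starRingEnd ℂ) s = s := Complex.conj_ofReal _
  -- The first column of `matQ p` dictates `PQ e = (1 - p) e + s v`; the second column then holds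
  -- exactly because `PQ` is idempotent.
  set v : ℕ → H := fun n => s⁻¹ • (PQ (e n) - (1 - p : ℂ) • e n) with hv
  -- All Gram entries of `e n`, `v n` are affine in this one error, with the identity matrix at `t =
  -- 0`.
  set t : ℕ → ℂ := fun n => ⟪e n, D (e n) - (p : ℂ) • e n⟫_ℂ with ht
  have htlim : Tendsto t atTop (𝓝 0) := by
    have h := hlim.norm
    rw [norm_zero] at h
    refine squeeze_zero_norm (fun n => ?_) h
    refine (norm_inner_le_norm _ _).trans_eq ?_
    rw [hn, one_mul]
  have corner : ∀ n, PR (PQ (e n)) = e n - PR (D (e n)) := fun n => by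
    have h := congrArg (· (e n)) (proj_mul_sq_sub_mul_proj hQ hR)
    simp only [mul_apply_eq_comp, sub_apply, he] at h
    exact h
  have g00 : ∀ n, ⟪e n, e n⟫_ℂ = 1 := fun n => by
    rw [inner_self_eq_norm_sq_to_K, hn]
    simp
  have gQ : ∀ n, ⟪e n, PQ (e n)⟫_ℂ = 1 - p - t n := fun n => by
    have h1 : ⟪e n, PQ (e n)⟫_ℂ = ⟪e n, PR (PQ (e n))⟫_ℂ := by rw [← sR, he]
    rw [h1, corner, inner_sub_right, ← sR, he, g00, ht]
    simp only [inner_sub_right, inner_smul_right, g00]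
    ring
  have gram : ∀ n, ContinuousLinearMap.adjoint (pairMap (e n) (v n)) ∘L pairMap (e n) (v n) =
      toOp !![1, -(s⁻¹ * t n); -(s⁻¹ * t n), 1 - s⁻¹ * s⁻¹ * (2 * p - 1) * t n] := fun n => by
    have g01 : ⟪e n, v n⟫_ℂ = -(s⁻¹ * t n) := by
      rw [hv]
      simp only [inner_sub_right, inner_smul_right, g00, gQ]
      ring
    have g10 : ⟪v n, e n⟫_ℂ = -(s⁻¹ * t n) := by
      rw [hv]
      simp only [inner_sub_left, inner_smul_left, g00, gQ, sQ, map_inv₀, hsc, map_sub, map_one,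
        Complex.conj_ofReal]
      ring
    have g11 : ⟪v n, v n⟫_ℂ = 1 - s⁻¹ * s⁻¹ * (2 * p - 1) * t n := by
      rw [hv]
      simp only [inner_sub_left, inner_smul_left, inner_sub_right, inner_smul_right, g00, gQ, sQ,
        iQ, map_inv₀, hsc, map_sub, map_one, Complex.conj_ofReal]
      field_simp
      rw [sq, hss]
      ring
    rw [adjoint_pairMap_comp, g00, g01, g10, g11]
  have l1 : Tendsto (fun n => ContinuousLinearMap.adjoint (pairMap (e n) (v n)) ∘L
      pairMap (e n) (v n) - 1) atTop (𝓝 0) := by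
    have hc : Continuous fun z : ℂ =>
        toOp !![1, -(s⁻¹ * z); -(s⁻¹ * z), 1 - s⁻¹ * s⁻¹ * (2 * p - 1) * z] := by
      refine continuous_toOp.comp (continuous_matrix fun i j => ?_)
      fin_cases i <;> fin_cases j <;> simp <;> fun_prop
    have h := ((hc.tendsto 0).comp htlim).sub_const 1
    have h1 : toOp !![1, -(s⁻¹ * 0); -(s⁻¹ * 0), 1 - s⁻¹ * s⁻¹ * (2 * p - 1) * 0] = 1 := by
      rw [← map_one toOp]
      congr 1
      ext i j
      fin_cases i <;> fin_cases j <;> simp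
    rw [h1, sub_self] at h
    refine h.congr fun n => ?_
    rw [gram]
    rfl
  have l2 : ∀ n, PQ ∘L pairMap (e n) (v n) - pairMap (e n) (v n) ∘L toOp (matQ p) = 0 := fun n => by
    refine ContinuousLinearMap.ext fun x => ?_
    simp only [sub_apply, zero_apply, ContinuousLinearMap.comp_apply, pairMap_apply,
      toOp_apply_zero, toOp_apply_one, matQ, hv, map_add, map_smul, map_sub, iQ]
    simp only [Matrix.of_apply, Matrix.cons_val', Matrix.cons_val_zero, Matrix.cons_val_one,
      Matrix.cons_val_fin_one, ← hs]
    push_cast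
    match_scalars
    · field_simp
      ring
    · field_simp
      linear_combination -(x 1) * hss
  have l3 : Tendsto (fun n => PR ∘L pairMap (e n) (v n) - pairMap (e n) (v n) ∘L toOp matR)
      atTop (𝓝 0) := by
    have h0 : Tendsto (fun n => ‖-s⁻¹‖ * ‖D (e n) - (p : ℂ) • e n‖) atTop (𝓝 0) := by
      simpa using hlim.norm.const_mul ‖-s⁻¹‖
    refine squeeze_zero_norm (fun n => ?_) h0
    -- The column of `e n` is exact since `PR (e n) = e n`; the other error is `PR (v n)`, given by
    -- `corner`.
    have h1 : PR ∘L pairMap (e n) (v n) - pairMap (e n) (v n) ∘L toOp matR =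
        pairMap 0 ((-s⁻¹) • PR (D (e n) - (p : ℂ) • e n)) := by
      refine ContinuousLinearMap.ext fun x => ?_
      simp only [sub_apply, ContinuousLinearMap.comp_apply, pairMap_apply, toOp_apply_zero,
        toOp_apply_one, matR, hv, map_add, map_smul, map_sub, he, corner]
      simp
      module
    rw [h1]
    refine (norm_pairMap_zero_le _).trans ?_
    rw [norm_smul]
    exact mul_le_mul_of_nonneg_left (norm_apply_le_of_isStarProjection hR _) (norm_nonneg _)
  intro ε hε
  have ev1 := l1.norm.eventually (gt_mem_nhds (by simpa using hε))
  have ev3 := l3.norm.eventually (gt_mem_nhds (by simpa using hε))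
  obtain ⟨n, h1, h3⟩ := (ev1.and ev3).exists
  exact ⟨_, h1, by rw [l2, norm_zero]; exact hε, h3⟩

theorem hasSpinorApprox (hQ : IsStarProjection PQ) (hR : IsStarProjection PR)
    (hσ : spectrum ℂ ((PQ - PR) ^ 2) = (fun p : ℝ => (p : ℂ)) '' Set.Icc (0 : ℝ) 1)
    {p : ℝ} (hp : p ∈ Set.Icc (0 : ℝ) 1) : HasSpinorApprox PQ PR p := by
  rw [← closure_Ioo zero_ne_one] at hp
  refine closure_minimal (fun q hq => ?_) (isClosed_hasSpinorApprox PQ PR) hp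
  refine hasSpinorApprox_of_mem_spectrum hQ hR hq.1 hq.2 ?_
  rw [hσ]
  exact ⟨q, Set.Ioo_subset_Icc_self hq, rfl⟩

theorem HasSpinorApprox.exists_isRepAt (hQ : IsStarProjection PQ) (hR : IsStarProjection PR)
    {p : ℝ} (h : HasSpinorApprox PQ PR p) :
    ∃ π : algO PQ PR →⋆ₐ[ℂ] (C2 →L[ℂ] C2), IsRepAt p π := by
  choose T h1 h2 h3 using fun n : ℕ => h (1 / ((n : ℝ) + 1)) Nat.one_div_pos_of_nat
  have h0 := tendsto_one_div_add_atTop_nhds_zero_nat (𝕜 := ℝ)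
  exact exists_starAlgHom_of_asympIntertwines (T := T)
    (tendsto_sub_nhds_zero_iff.1 (squeeze_zero_norm (fun n => (h1 n).le) h0))
    hQ.isSelfAdjoint hR.isSelfAdjoint ((isSelfAdjoint_matQ p).map toOp)
    (isSelfAdjoint_matR.map toOp) (squeeze_zero_norm (fun n => (h2 n).le) h0)
    (squeeze_zero_norm (fun n => (h3 n).le) h0)

end SpinorExistence

/-! ### Density and uniqueness -/

section Uniqueness

variable {PQ PR : H →L[ℂ] H}

theorem algO_induction {P : algO PQ PR → Prop} (hcl : IsClosed {a | P a})
    (genQ : P (genQ PQ PR)) (genR : P (genR PQ PR)) (algebraMap : ∀ c, P (algebraMap ℂ _ c))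
    (add : ∀ a b, P a → P b → P (a + b)) (mul : ∀ a b, P a → P b → P (a * b))
    (star : ∀ a, P a → P (star a)) (a : algO PQ PR) : P a := by
  have key : ∀ B (hB : B ∈ StarAlgebra.adjoin ℂ ({PQ, PR} : Set (H →L[ℂ] H))),
      P ⟨B, StarSubalgebra.le_topologicalClosure _ hB⟩ := by
    intro B hB
    induction hB using StarAlgebra.adjoin_induction with
    | mem x hx =>
      rcases hx with rfl | rfl
      · exact genQ
      · exact genR
    | algebraMap r => exact algebraMap r
    | add x y h h' hx hy =>
      exact add ⟨x, StarSubalgebra.le_topologicalClosure _ h⟩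
        ⟨y, StarSubalgebra.le_topologicalClosure _ h'⟩ hx hy
    | mul x y h h' hx hy =>
      exact mul ⟨x, StarSubalgebra.le_topologicalClosure _ h⟩
        ⟨y, StarSubalgebra.le_topologicalClosure _ h'⟩ hx hy
    | star x h hx => exact star ⟨x, StarSubalgebra.le_topologicalClosure _ h⟩ hx
  obtain ⟨A, hA, hlim⟩ := mem_closure_iff_seq_limit.1 a.2
  have hlim' : Tendsto (fun k => (⟨A k, StarSubalgebra.le_topologicalClosure _ (hA k)⟩ :
      algO PQ PR)) atTop (𝓝 a) := by
    rw [tendsto_subtype_rng]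
    exact hlim
  have hev : ∀ k, P ⟨A k, StarSubalgebra.le_topologicalClosure _ (hA k)⟩ := fun k => key _ (hA k)
  exact hcl.mem_of_tendsto hlim' (Eventually.of_forall hev)

theorem continuous_rep {K : Type*} [NormedAddCommGroup K] [InnerProductSpace ℂ K] [CompleteSpace K]
    (π : algO PQ PR →⋆ₐ[ℂ] (K →L[ℂ] K)) : Continuous π := by
  -- Closedness makes the algebra a `C*`-algebra, where `*`-homomorphisms are contractive.
  have : IsClosed (algO PQ PR : Set (H →L[ℂ] H)) :=
    StarSubalgebra.isClosed_topologicalClosure _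
  exact AddMonoidHomClass.continuous_of_bound π 1 fun a => by
    rw [one_mul]
    exact NonUnitalStarAlgHom.norm_apply_le π a

theorem IsRepAt.unique {p : ℝ} {π π' : algO PQ PR →⋆ₐ[ℂ] (C2 →L[ℂ] C2)} (h : IsRepAt p π)
    (h' : IsRepAt p π') : π' = π := by
  refine StarAlgHom.ext fun a => ?_
  refine algO_induction (P := fun a => π' a = π a)
    (isClosed_eq (continuous_rep π') (continuous_rep π)) (h'.1.trans h.1.symm)
    (h'.2.trans h.2.symm) (fun c => ?_) (fun a b ha hb => ?_) (fun a b ha hb => ?_)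
    (fun a ha => ?_) a
  · rw [AlgHomClass.commutes, AlgHomClass.commutes]
  · rw [map_add, map_add, ha, hb]
  · rw [map_mul, map_mul, ha, hb]
  · rw [map_star, map_star, ha]

end Uniqueness

/-! ### Diagonal and surjective representations on `ℂ²` -/

section Coordinates

/-- The standard basis vectors of `ℂ²`. -/
def stdVec (i : Fin 2) : C2 := EuclideanSpace.single i 1

/-- Every operator in the image of `ρ` is diagonal. -/
def IsDiagonal {α : Type*} (ρ : α → (C2 →L[ℂ] C2)) : Prop :=
  ∀ a x i, ρ a x i = ρ a (stdVec i) i * x i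

variable {𝓐 : Type*} [NonUnitalSemiring 𝓐] [Star 𝓐] [Module ℂ 𝓐]

/-- The `i`-th diagonal entry of a representation by diagonal operators. -/
def diagRep (ρ : 𝓐 →⋆ₙₐ[ℂ] (C2 →L[ℂ] C2)) (h : IsDiagonal ρ) (i : Fin 2) :
    𝓐 →⋆ₙₐ[ℂ] (ℂ →L[ℂ] ℂ) where
  toFun a := algebraMap ℂ _ (ρ a (stdVec i) i)
  map_smul' c a := by
    rw [map_smul, MonoidHom.id_apply, smul_apply, PiLp.smul_apply, smul_eq_mul, map_mul]
    exact (Algebra.smul_def _ _).symm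
  map_zero' := by rw [map_zero, zero_apply, PiLp.zero_apply, map_zero]
  map_add' a b := by rw [map_add, add_apply, PiLp.add_apply, map_add]
  map_mul' a b := by rw [map_mul, mul_apply_eq_comp, h a, map_mul]
  map_star' a := by
    rw [map_star, ← algebraMap_star_comm]
    congr 1
    have h1 := ContinuousLinearMap.adjoint_inner_right (ρ a) (stdVec i) (stdVec i)
    simp only [stdVec, EuclideanSpace.inner_single_left, EuclideanSpace.inner_single_right] at h1
    simpa [stdVec, ContinuousLinearMap.star_eq_adjoint] using h1

theorem diagRep_apply (ρ : 𝓐 →⋆ₙₐ[ℂ] (C2 →L[ℂ] C2)) (h : IsDiagonal ρ) (i : Fin 2) (a : 𝓐) :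
    diagRep ρ h i a = algebraMap ℂ _ (ρ a (stdVec i) i) := rfl

/-- `ℂ²` as the Hilbert space direct sum of two copies of `ℂ`. -/
def splitC2 : C2 ≃ₗᵢ[ℂ] WithLp 2 (ℂ × ℂ) where
  toFun x := WithLp.toLp 2 (x 0, x 1)
  invFun y := !₂[y.fst, y.snd]
  map_add' _ _ := rfl
  map_smul' _ _ := rfl
  left_inv x := by
    ext i
    fin_cases i <;> rfl
  right_inv _ := rfl
  norm_map' x := by
    rw [EuclideanSpace.norm_eq, Fin.sum_univ_two]
    exact WithLp.prod_norm_eq_of_L2 _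

theorem isDirectSum_diagRep (ρ : 𝓐 →⋆ₙₐ[ℂ] (C2 →L[ℂ] C2)) (h : IsDiagonal ρ) :
    IsDirectSum ρ (diagRep ρ h 0) (diagRep ρ h 1) := by
  refine ⟨splitC2, fun a x => ?_⟩
  change WithLp.toLp 2 (ρ a x 0, ρ a x 1) = _
  rw [h a x 0, h a x 1]
  rfl

/-- The first coordinate axis is invariant and proper. -/
theorem not_isIrreducible_of_isDiagonal (ρ : 𝓐 →⋆ₙₐ[ℂ] (C2 →L[ℂ] C2)) (h : IsDiagonal ρ) :
    ¬ IsIrreducible ρ := by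
  rintro ⟨-, hV⟩
  have hmem : ∀ x : C2, x ∈ LinearMap.ker (EuclideanSpace.proj (1 : Fin 2) : C2 →L[ℂ] ℂ).toLinearMap
      ↔ x 1 = 0 := fun x => Iff.rfl
  rcases hV (LinearMap.ker (EuclideanSpace.proj (1 : Fin 2) : C2 →L[ℂ] ℂ).toLinearMap)
    (Submodule.closed_of_finiteDimensional _) (fun a x hx => by
      rw [hmem] at hx ⊢
      rw [h, hx, mul_zero]) with h1 | h1
  · have h2 := (hmem (stdVec 0)).2 (by simp [stdVec])
    rw [h1, Submodule.mem_bot] at h2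
    simpa [stdVec] using congrArg (· 0) h2
  · have h2 := (hmem (stdVec 1)).1 (h1 ▸ Submodule.mem_top)
    simp [stdVec] at h2

/-- A rank-one operator carries a nonzero `x` to a nonzero multiple of any `y`. -/
theorem isIrreducible_of_surjective (ρ : 𝓐 →⋆ₙₐ[ℂ] (C2 →L[ℂ] C2)) (h : Function.Surjective ρ) :
    IsIrreducible ρ := by
  obtain ⟨a, ha⟩ := h 1
  refine ⟨⟨a, ha ▸ one_ne_zero⟩, fun V _ hV => ?_⟩
  rw [or_iff_not_imp_left]
  intro hne
  obtain ⟨x, hx, hx0⟩ := Submodule.exists_mem_ne_zero_of_ne_bot hne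
  refine (Submodule.eq_top_iff').2 fun y => ?_
  obtain ⟨b, hb⟩ := h ((innerSL ℂ x).smulRight y)
  have h1 := hV b x hx
  rw [hb, ContinuousLinearMap.smulRight_apply, innerSL_apply_apply] at h1
  exact (V.smul_mem_iff (inner_self_ne_zero.2 hx0)).1 h1

/-- An operator commuting with `diag(1, 0)` preserves both of its eigenlines. -/
theorem isDiagonal_of_commute {α : Type*} {ρ : α → (C2 →L[ℂ] C2)}
    (h : ∀ a, Commute (ρ a) (toOp matR)) : IsDiagonal ρ := by
  intro a x i
  have hE : ∀ y, toOp matR y = y 0 • stdVec 0 := fun y => by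
    ext j
    fin_cases j
    · simp only [Fin.zero_eta, toOp_apply_zero]
      simp [matR, stdVec]
    · simp only [Fin.mk_one, toOp_apply_one]
      simp [matR, stdVec]
  have hc : ∀ y, ρ a (toOp matR y) = toOp matR (ρ a y) := fun y => congrArg (· y) (h a).eq
  have h0 : ∀ y, y 0 • ρ a (stdVec 0) = ρ a y 0 • stdVec 0 := fun y => by
    rw [← hE, ← hc, hE, map_smul]
  have hx : x = x 0 • stdVec 0 + x 1 • stdVec 1 := by
    ext j
    fin_cases j <;> simp [stdVec]
  fin_cases i
  · have := congrArg (· 0) (h0 x)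
    simp [stdVec] at this ⊢
    rw [← this, mul_comm]
  · have h1 : ρ a (stdVec 0) 1 = 0 := by
      have := congrArg (· 1) (h0 (stdVec 0))
      simpa [stdVec] using this
    have h2 : ρ a x 1 = x 0 * ρ a (stdVec 0) 1 + x 1 * ρ a (stdVec 1) 1 := by
      conv_lhs => rw [hx]
      rw [map_add, map_smul, map_smul]
      rfl
    rw [h1, mul_zero, zero_add, mul_comm] at h2
    exact h2

end Coordinates

/-! ### The commuting case and the common kernel -/

section Endpoints

variable {PQ PR : H →L[ℂ] H} {p : ℝ} {π : algO PQ PR →⋆ₐ[ℂ] (C2 →L[ℂ] C2)}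

theorem IsRepAt.isDiagonal (h : IsRepAt p π) (hp : Commute (matQ p) matR) : IsDiagonal π := by
  refine isDiagonal_of_commute fun a => ?_
  have sR : IsSelfAdjoint (toOp matR) := isSelfAdjoint_matR.map toOp
  refine algO_induction (P := fun a => Commute (π a) (toOp matR)) ?_ ?_ ?_ (fun c => ?_)
    (fun a b ha hb => ?_) (fun a b ha hb => ?_) (fun a ha => ?_) a
  · exact isClosed_eq ((continuous_rep π).mul continuous_const)
      (continuous_const.mul (continuous_rep π))
  · rw [h.1]
    exact hp.map toOp
  · rw [h.2]
  · rw [AlgHomClass.commutes]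
    exact Algebra.commutes c _
  · rw [map_add]
    exact ha.add_left hb
  · rw [map_mul]
    exact ha.mul_left hb
  · rw [map_star]
    have := ha.star_star
    rwa [sR.star_eq] at this

/-- On `(Im P_Q)^⊥ ∩ (Im P_R)^⊥` the algebra acts through the character killing the generators. -/
theorem IsRepAt.apply_of_mem_coIm (hQ : IsStarProjection PQ) (hR : IsStarProjection PR)
    (h : IsRepAt 0 π) (hd : IsDiagonal π) {f : H} (hf : f ∈ coIm PQ PR) (a : algO PQ PR) :
    (a : H →L[ℂ] H) f = π a (stdVec 1) 1 • f := by
  have hc : Continuous fun a : algO PQ PR => π a (stdVec 1) 1 :=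
    (EuclideanSpace.proj (1 : Fin 2) : C2 →L[ℂ] ℂ).continuous.comp
      ((ContinuousLinearMap.apply ℂ C2 (stdVec 1)).continuous.comp (continuous_rep π))
  have hv : Continuous fun a : algO PQ PR => (a : H →L[ℂ] H) f :=
    (ContinuousLinearMap.apply ℂ H f).continuous.comp continuous_subtype_val
  -- The claim for `star a` is included so that the star step closes; products use that diagonal
  -- entries multiply.
  refine (algO_induction (P := fun a : algO PQ PR =>
    (a : H →L[ℂ] H) f = π a (stdVec 1) 1 • f ∧
      ((star a : algO PQ PR) : H →L[ℂ] H) f = π (star a) (stdVec 1) 1 • f)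
    ?_ ?_ ?_ (fun c => ?_) (fun a b ha hb => ?_) (fun a b ha hb => ?_) (fun a ha => ?_) a).1
  · exact (isClosed_eq hv (hc.smul continuous_const)).inter
      (isClosed_eq (hv.comp continuous_star) ((hc.comp continuous_star).smul continuous_const))
  · have hs : star (genQ PQ PR) = genQ PQ PR := Subtype.ext hQ.isSelfAdjoint
    have h1 : (genQ PQ PR : H →L[ℂ] H) f = π (genQ PQ PR) (stdVec 1) 1 • f := by
      rw [h.1, toOp_apply_one]
      simpa [stdVec, matQ, genQ] using coIm_apply_left hQ hf
    exact ⟨h1, by rwa [hs]⟩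
  · have hs : star (genR PQ PR) = genR PQ PR := Subtype.ext hR.isSelfAdjoint
    have h1 : (genR PQ PR : H →L[ℂ] H) f = π (genR PQ PR) (stdVec 1) 1 • f := by
      rw [h.2, toOp_apply_one]
      simpa [stdVec, matR, genR] using coIm_apply_right hR hf
    exact ⟨h1, by rwa [hs]⟩
  · have h1 : ∀ c : ℂ, ((algebraMap ℂ (algO PQ PR) c : algO PQ PR) : H →L[ℂ] H) f =
        π (algebraMap ℂ _ c) (stdVec 1) 1 • f := fun c => by
      rw [AlgHomClass.commutes]
      simp [Algebra.algebraMap_eq_smul_one, stdVec]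
    exact ⟨h1 c, by rw [← algebraMap_star_comm]; exact h1 _⟩
  · have hadd : ∀ a b : algO PQ PR, (a : H →L[ℂ] H) f = π a (stdVec 1) 1 • f →
        (b : H →L[ℂ] H) f = π b (stdVec 1) 1 • f →
        ((a + b : algO PQ PR) : H →L[ℂ] H) f = π (a + b) (stdVec 1) 1 • f := fun a b ha hb => by
      rw [map_add, add_apply, PiLp.add_apply, add_smul, ← ha, ← hb]
      rfl
    exact ⟨hadd _ _ ha.1 hb.1, by rw [star_add]; exact hadd _ _ ha.2 hb.2⟩
  · have hmul : ∀ a b : algO PQ PR, (a : H →L[ℂ] H) f = π a (stdVec 1) 1 • f →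
        (b : H →L[ℂ] H) f = π b (stdVec 1) 1 • f →
        ((a * b : algO PQ PR) : H →L[ℂ] H) f = π (a * b) (stdVec 1) 1 • f := fun a b ha hb => by
      rw [map_mul, mul_apply_eq_comp, hd a, mul_comm, mul_smul, ← ha, ← map_smul, ← hb]
      rfl
    exact ⟨hmul _ _ ha.1 hb.1, by rw [star_mul]; exact hmul _ _ hb.2 ha.2⟩
  · exact ⟨ha.2, by rw [star_star]; exact ha.1⟩

end Endpoints

theorem IsRepAt.surjective_restrict {PQ PR : H →L[ℂ] H} (hQ : IsStarProjection PQ)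
    (hR : IsStarProjection PR) {p : ℝ} {π : algO PQ PR →⋆ₐ[ℂ] (C2 →L[ℂ] C2)} (h : IsRepAt p π)
    (hp0 : 0 < p) (hp1 : p < 1) : Function.Surjective (restrict hQ hR π) := by
  intro M
  obtain ⟨m, rfl⟩ := toOp.surjective M
  have eQ : restrict hQ hR π (genQ' hQ hR) = toOp (matQ p) := h.1
  have eR : restrict hQ hR π (genR' hQ hR) = toOp matR := h.2
  set q := genQ' hQ hR
  set r := genR' hQ hR
  have hpp : 0 < p * (1 - p) := mul_pos hp0 (by linarith)
  have hs0 : ((Real.sqrt (p * (1 - p)) : ℝ) : ℂ) ≠ 0 := by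
    exact_mod_cast (Real.sqrt_pos.2 hpp).ne'
  have hp : (p : ℂ) ≠ 0 := by exact_mod_cast hp0.ne'
  set s : ℂ := ((Real.sqrt (p * (1 - p)) : ℝ) : ℂ) with hs
  -- The four brackets map to `E₁₁`, `s E₂₁`, `s E₁₂` and `p E₂₂`. They are the corners of `q`
  -- relative to `r`, expanded so that no unit is needed.
  refine ⟨m 0 0 • r + (s⁻¹ * m 1 0) • (q * r - r * q * r) + (s⁻¹ * m 0 1) • (r * q - r * q * r) +
    ((p : ℂ)⁻¹ * m 1 1) • (q - q * r - r * q + r * q * r), ?_⟩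
  simp only [map_add, map_sub, map_smul, map_mul, eQ, eR]
  simp only [← map_add, ← map_sub, ← map_smul, ← map_mul]
  refine congrArg toOp ?_
  ext i j
  fin_cases i <;> fin_cases j <;>
    simp [matQ, matR, ← hs] <;> field_simp

end TwoProjections

end

/-! ### The classification by parameter -/

theorem mainTheorem2 {H : Type*} [NormedAddCommGroup H] [InnerProductSpace ℂ H] [CompleteSpace H]
    (PQ PR : H →L[ℂ] H) (hQ : IsStarProjection PQ) (hR : IsStarProjection PR)
    (hσ : spectrum ℂ ((PQ - PR) ^ 2) = (fun p : ℝ => (p : ℂ)) '' Set.Icc (0 : ℝ) 1) :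
    ∃ π : Set.Icc (0 : ℝ) 1 →
        (TwoProjections.algO PQ PR →⋆ₐ[ℂ] (TwoProjections.C2 →L[ℂ] TwoProjections.C2)),
      -- for each `p`, `π p` is the unique representation at the parameter `p`
      (∀ p : Set.Icc (0 : ℝ) 1, TwoProjections.IsRepAt (p : ℝ) (π p) ∧
        ∀ π' : TwoProjections.algO PQ PR →⋆ₐ[ℂ] (TwoProjections.C2 →L[ℂ] TwoProjections.C2),
          TwoProjections.IsRepAt (p : ℝ) π' → π' = π p) ∧
      -- `p = 0`: a one-dimensional representation `χ`; the complementary summand `χ₀` kills the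
      -- generators, and is zero as soon as `(Im P_Q)^⊥ ∩ (Im P_R)^⊥ ≠ 0`
      (∀ p : Set.Icc (0 : ℝ) 1, (p : ℝ) = 0 →
        ∃ χ χ₀ : TwoProjections.idealO hQ hR →⋆ₙₐ[ℂ] (ℂ →L[ℂ] ℂ),
          TwoProjections.IsDirectSum (TwoProjections.restrict hQ hR (π p)) χ χ₀ ∧
          χ (TwoProjections.genQ' hQ hR) = 1 ∧ χ (TwoProjections.genR' hQ hR) = 1 ∧
          χ₀ (TwoProjections.genQ' hQ hR) = 0 ∧ χ₀ (TwoProjections.genR' hQ hR) = 0 ∧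
          (TwoProjections.coIm PQ PR ≠ ⊥ → ∀ A, χ₀ A = 0)) ∧
      -- `0 < p < 1`: an irreducible representation by all operators on `ℂ²`
      (∀ p : Set.Icc (0 : ℝ) 1, 0 < (p : ℝ) → (p : ℝ) < 1 →
        TwoProjections.IsIrreducible (TwoProjections.restrict hQ hR (π p)) ∧
        Function.Surjective (TwoProjections.restrict hQ hR (π p))) ∧
      -- `p = 1`: a reducible representation, the sum of two one-dimensional ones
      (∀ p : Set.Icc (0 : ℝ) 1, (p : ℝ) = 1 →
        ¬ TwoProjections.IsIrreducible (TwoProjections.restrict hQ hR (π p)) ∧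
        ∃ χ₁ χ₂ : TwoProjections.idealO hQ hR →⋆ₙₐ[ℂ] (ℂ →L[ℂ] ℂ),
          TwoProjections.IsDirectSum (TwoProjections.restrict hQ hR (π p)) χ₁ χ₂ ∧
          χ₁ (TwoProjections.genQ' hQ hR) = 0 ∧ χ₁ (TwoProjections.genR' hQ hR) = 1 ∧
          χ₂ (TwoProjections.genQ' hQ hR) = 1 ∧ χ₂ (TwoProjections.genR' hQ hR) = 0) := by
  have hex : ∀ p : Set.Icc (0 : ℝ) 1, ∃ π : TwoProjections.algO PQ PR →⋆ₐ[ℂ]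
      (TwoProjections.C2 →L[ℂ] TwoProjections.C2), TwoProjections.IsRepAt (p : ℝ) π :=
    fun p => (TwoProjections.hasSpinorApprox hQ hR hσ p.2).exists_isRepAt hQ hR
  choose π hπ using hex
  refine ⟨π, fun p => ⟨hπ p, fun π' h' => (hπ p).unique h'⟩, fun p hp => ?_, fun p h0 h1 => ?_,
    fun p hp => ?_⟩
  · have h := hπ p
    rw [hp] at h
    have hd := h.isDiagonal (by
      rw [commute_iff_eq]
      ext i j
      fin_cases i <;> fin_cases j <;> simp [TwoProjections.matQ, TwoProjections.matR])
    have hd' : TwoProjections.IsDiagonal (TwoProjections.restrict hQ hR (π p)) := fun a => hd _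
    have eQ : TwoProjections.restrict hQ hR (π p) (TwoProjections.genQ' hQ hR) = _ := h.1
    have eR : TwoProjections.restrict hQ hR (π p) (TwoProjections.genR' hQ hR) = _ := h.2
    refine ⟨TwoProjections.diagRep _ hd' 0, TwoProjections.diagRep _ hd' 1,
      TwoProjections.isDirectSum_diagRep _ hd', ?_, ?_, ?_, ?_, fun hN A => ?_⟩
    · rw [TwoProjections.diagRep_apply, eQ, TwoProjections.toOp_apply_zero]
      simp [TwoProjections.stdVec, TwoProjections.matQ]
    · rw [TwoProjections.diagRep_apply, eR, TwoProjections.toOp_apply_zero]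
      simp [TwoProjections.stdVec, TwoProjections.matR]
    · rw [TwoProjections.diagRep_apply, eQ, TwoProjections.toOp_apply_one]
      simp [TwoProjections.stdVec, TwoProjections.matQ]
    · rw [TwoProjections.diagRep_apply, eR, TwoProjections.toOp_apply_one]
      simp [TwoProjections.stdVec, TwoProjections.matR]
    -- On a nonzero `f` in the common kernel, `A f` is both `0` and the second diagonal entry times
    -- `f`.
    · obtain ⟨f, hf, hf0⟩ := Submodule.exists_mem_ne_zero_of_ne_bot hN
      have h1 := h.apply_of_mem_coIm hQ hR hd hf (TwoProjections.incl hQ hR A)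
      have h2 : (TwoProjections.incl hQ hR A : H →L[ℂ] H) f = 0 := A.2.2 f hf
      rw [h2, eq_comm, smul_eq_zero, or_iff_left hf0] at h1
      rw [TwoProjections.diagRep_apply]
      change algebraMap ℂ _ (π p (TwoProjections.incl hQ hR A) (TwoProjections.stdVec 1) 1) = 0
      rw [h1, map_zero]
  · have hs := (hπ p).surjective_restrict hQ hR h0 h1
    exact ⟨TwoProjections.isIrreducible_of_surjective _ hs, hs⟩
  · have h := hπ p
    rw [hp] at h
    have hd := h.isDiagonal (by
      rw [commute_iff_eq]
      ext i j
      fin_cases i <;> fin_cases j <;> simp [TwoProjections.matQ, TwoProjections.matR])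
    have hd' : TwoProjections.IsDiagonal (TwoProjections.restrict hQ hR (π p)) := fun a => hd _
    have eQ : TwoProjections.restrict hQ hR (π p) (TwoProjections.genQ' hQ hR) = _ := h.1
    have eR : TwoProjections.restrict hQ hR (π p) (TwoProjections.genR' hQ hR) = _ := h.2
    refine ⟨TwoProjections.not_isIrreducible_of_isDiagonal _ hd',
      TwoProjections.diagRep _ hd' 0, TwoProjections.diagRep _ hd' 1,
      TwoProjections.isDirectSum_diagRep _ hd', ?_, ?_, ?_, ?_⟩
    · rw [TwoProjections.diagRep_apply, eQ, TwoProjections.toOp_apply_zero]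
      simp [TwoProjections.stdVec, TwoProjections.matQ]
    · rw [TwoProjections.diagRep_apply, eR, TwoProjections.toOp_apply_zero]
      simp [TwoProjections.stdVec, TwoProjections.matR]
    · rw [TwoProjections.diagRep_apply, eQ, TwoProjections.toOp_apply_one]
      simp [TwoProjections.stdVec, TwoProjections.matQ]
    · rw [TwoProjections.diagRep_apply, eR, TwoProjections.toOp_apply_one]
      simp [TwoProjections.stdVec, TwoProjections.matR]
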